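/- Let $0<\varepsilon<1$, $\delta>0$, $0<\lambda<1$, $0<\alpha<1$, and let $(k_n)$ be a sequence of real numbers with $$k_n\to\infty,\qquad \frac{k_n}{\log n}\to\infty,\qquad \frac{\log k_n}{\log n}\to 0\qquad (n\to\infty).$$ Put $$\lambda_n:=\lambda\,\frac{\log n}{n^{\alpha}},\qquad \tilde\lambda_n:=\lambda_n\left(1+2\sqrt{\frac{2(1-\lambda_n)}{\lambda\, n^{(1-\alpha)/2}}}\right),$$ let $\Phi$ be the standard Gaussian distribution function, and for $0<u<1$ let $G(u)$ be the solution of $1-\Phi(G(u))=u$. For each $n$ let $X_1,\dots,X_n$ be i.i.d. standard Gaussian random variables on a probability space, with order statistics $X_{1,n}\le\dots\le X_{n,n}$ (the variables and the probability space may depend on $n$). Then there is an integer $n_0$, depending only on $\varepsilon,\delta,\lambda,\alpha$ and the sequence $(k_n)$, such that for all $n\ge n_0$ there is an event $\Omega_n$ with $$\mathbb P[\Omega_n]\ \ge\ 1-4\left(\frac{1}{(\log n)^{1+\delta}}+\frac{e^{-k_n/16}}{1-e^{-1/16}}\right)$$ such that on $\Omega_n$: for all integers $1\le j\le n$ with $k_n\le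 j\le n\tilde\lambda_n$, $$\sqrt{2\log n}\,(X_{j,n}-X_{1,n})\ \ge\ 2\log n\left(1-\sqrt{1-\frac{\log j}{\log n}}\right)(1-\varepsilon),$$ while for all integers $1\le j\le n$ with $n\tilde\lambda_n\le j\le n$, $$\sqrt{2\log n}\,(X_{j,n}-X_{1,n})\ >\ 2\log n\,\sqrt{1-\varepsilon}-G(\lambda_n)\sqrt{2\log n}.\qquad(*)$$ In particular, for every sequence of integers $1\le j_n\le n$ with $\log j_n/\log n\to1$, for all sufficiently large $n$ the inequality $(*)$ with $j=j_n$ holds on $\Omega_n$. -/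

import Mathlib

open MeasureTheory ProbabilityTheory Filter Topology

namespace GaussianSpacings

/-- The standard Gaussian distribution function `Φ`. -/
noncomputable def Phi (x : ℝ) : ℝ := cdf (gaussianReal 0 1) x

/-- The upper quantile function of the standard Gaussian law: for `0 < u < 1`, `G u` is the
solution `x` of `1 - Φ x = u` (see `one_sub_Phi_G`). -/
noncomputable def G (u : ℝ) : ℝ := sInf {x : ℝ | 1 - Phi x ≤ u}

lemma continuous_Phi : Continuous Phi := by
  have hmono : Monotone (cdf (gaussianReal 0 1)) := monotone_cdf _
  rw [continuous_iff_continuousAt]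
  intro x
  have h := (cdf (gaussianReal 0 1)).measure_singleton x
  rw [measure_cdf] at h
  have h0 : gaussianReal 0 1 {x} = 0 := by
    have := nullSingletonClass_gaussianReal (μ := 0) (v := 1) one_ne_zero
    exact measure_singleton x
  rw [h0] at h
  have h1 := ENNReal.ofReal_eq_zero.mp h.symm
  have h2 := hmono.leftLim_le (le_refl x)
  exact (hmono.continuousAt_iff_leftLim_eq_rightLim).2
    (by rw [StieltjesFunction.rightLim_eq]; linarith)

lemma one_sub_Phi_G {u : ℝ} (h0 : 0 < u) (h1 : u < 1) : 1 - Phi (G u) = u := by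
  have hbot : Tendsto Phi atBot (𝓝 0) := tendsto_cdf_atBot _
  have htop : Tendsto Phi atTop (𝓝 1) := tendsto_cdf_atTop _
  have hmono : Monotone Phi := monotone_cdf _
  obtain ⟨a, ha⟩ := (hbot.eventually (gt_mem_nhds (show (0 : ℝ) < 1 - u by linarith))).exists
  obtain ⟨b, hb⟩ := (htop.eventually (lt_mem_nhds (show 1 - u < (1 : ℝ) by linarith))).exists
  set S : Set ℝ := {x : ℝ | 1 - Phi x ≤ u} with hS
  have hne : S.Nonempty := ⟨b, by simp only [hS, Set.mem_ofPred_eq]; linarith⟩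
  have hbdd : BddBelow S := ⟨a, fun x hx => by
    by_contra! hlt
    have := hmono hlt.le
    simp only [hS, Set.mem_ofPred_eq] at hx
    linarith⟩
  have hcl : IsClosed S :=
    isClosed_le (continuous_const.sub continuous_Phi) continuous_const
  have hmem : 1 - Phi (G u) ≤ u := hcl.csInf_mem hne hbdd
  refine le_antisymm hmem ?_
  by_contra! hlt
  have hopen : IsOpen {x : ℝ | 1 - Phi x < u} :=
    isOpen_lt (continuous_const.sub continuous_Phi) continuous_const
  obtain ⟨r, hr, hball⟩ := Metric.isOpen_iff.1 hopen (G u) hlt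
  have hx : G u - r / 2 ∈ Metric.ball (G u) r := by
    rw [Metric.mem_ball, Real.dist_eq, abs_lt]
    constructor <;> linarith
  have hle : G u ≤ G u - r / 2 := by
    have h3 : 1 - Phi (G u - r / 2) < u := hball hx
    exact csInf_le hbdd (show 1 - Phi (G u - r / 2) ≤ u from h3.le)
  linarith

/-- The `j`-th order statistic `Y_{j,n}` (`1 ≤ j ≤ n`, increasing order) of `Y₁, …, Yₙ`:
`Tuple.sort Y` is a permutation that rearranges `Y` into a nondecreasing tuple.
The value outside `1 ≤ j ≤ n` is irrelevant. -/
noncomputable def orderStat {n : ℕ} (Y : Fin n → ℝ) (j : ℕ) : ℝ :=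
  if h : 1 ≤ j ∧ j ≤ n then Y (Tuple.sort Y ⟨j - 1, by omega⟩) else 0

/-- `λ_n = λ log n / n ^ α`. -/
noncomputable def lam (l α : ℝ) (n : ℕ) : ℝ := l * (Real.log n / (n : ℝ) ^ α)

/-- `λ̃_n = λ_n (1 + 2 √(2 (1 - λ_n) / (λ n ^ ((1 - α) / 2))))`. -/
noncomputable def lamTilde (l α : ℝ) (n : ℕ) : ℝ :=
  lam l α n *
    (1 + 2 * √(2 * (1 - lam l α n) / (l * (n : ℝ) ^ ((1 - α) / 2))))

end GaussianSpacings

namespace GaussianSpacings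

/-! ### Gaussian tails -/

/-! Write `N = log n`. The good event excludes three kinds of deviation, each controlled by counting
how many of the variables fall below a level. The minimum exceeds `-t` with probability at most `exp
(-L)`, `L = (1 + δ) log N`, once the tail at `-t` is at least `L / n`. For each `j`, at least `j`
variables lie below `-u_j`, where the mean count is at most `j / 2`, with probability at most `exp
(-j / 16)` by Chernoff, and these sum geometrically over `j ≥ k_n`. The count below `-G(λ_n)` has
mean `n λ_n`, and Chebyshev bounds its chance of reaching `n λ̃_n`. See
`one_sub_le_measureReal_goodEvent`. On the good event the spacing exceeds `t - u_j`. Mills-type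
bounds give `t² = 2N - a` and `u_j² = 2(N - log j) - b`, where `a` and `b` both contain `log N`.
This term cancels in `a - b`, leaving order `log log N`, which is absorbed by `2ε log j` because `j
≥ k_n ≥ N`. Then `spacing_le_mul_sub` concludes. For `j ≥ n λ̃_n`, `-G(λ_n)` replaces `-u_j`, and `t
≥ √(2N) √(1 - ε)` suffices. -/

lemma gaussianReal_real_eq_integral (s : Set ℝ) :
    (gaussianReal 0 1).real s = ∫ x in s, gaussianPDFReal 0 1 x := by
  rw [measureReal_def, gaussianReal_apply_eq_integral 0 one_ne_zero,
    ENNReal.toReal_ofReal (integral_nonneg fun x => gaussianPDFReal_nonneg 0 1 x)]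

lemma gaussianReal_Iic_neg (x : ℝ) : (gaussianReal 0 1).real (Set.Iic (-x)) = 1 - Phi x := by
  have h := gaussianReal_map_neg (μ := 0) (v := 1)
  rw [neg_zero] at h
  have hnull : NullSingletonClass (gaussianReal 0 1) :=
    nullSingletonClass_gaussianReal one_ne_zero
  have h1 : (gaussianReal 0 1).real (Set.Iic (-x)) = (gaussianReal 0 1).real (Set.Ici x) := by
    conv_lhs => rw [← h]
    rw [map_measureReal_apply measurable_neg measurableSet_Iic]
    congr 1
    ext y
    simp
  have h2 : (gaussianReal 0 1).real (Set.Ici x) = (gaussianReal 0 1).real (Set.Ioi x) :=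
    measureReal_congr Ioi_ae_eq_Ici.symm
  rw [h1, h2, ← Set.compl_Iic, probReal_compl_eq_one_sub measurableSet_Iic, Phi, cdf_eq_real]

/-- Since `(x + u)² ≥ 0`, the density is dominated by `exp (u² / 2 + u x)`, whose integral is
explicit. -/
lemma gaussianReal_Iic_neg_le {u : ℝ} (hu : 0 < u) :
    (gaussianReal 0 1).real (Set.Iic (-u)) ≤ Real.exp (-u ^ 2 / 2) / u := by
  have hint : IntegrableOn (fun x => Real.exp (u ^ 2 / 2) * Real.exp (u * x)) (Set.Iic (-u)) :=
    (integrableOn_exp_mul_Iic hu _).const_mul _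
  have hpi : (√(2 * Real.pi))⁻¹ ≤ 1 := by
    apply inv_le_one_of_one_le₀
    rw [Real.one_le_sqrt]
    linarith [Real.pi_gt_three]
  calc (gaussianReal 0 1).real (Set.Iic (-u))
      = ∫ x in Set.Iic (-u), gaussianPDFReal 0 1 x := gaussianReal_real_eq_integral _
    _ ≤ ∫ x in Set.Iic (-u), Real.exp (u ^ 2 / 2) * Real.exp (u * x) := by
      refine setIntegral_mono (integrable_gaussianPDFReal 0 1).integrableOn hint fun x => ?_
      simp only [gaussianPDFReal, NNReal.coe_one, mul_one, sub_zero]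
      rw [← Real.exp_add]
      refine (mul_le_of_le_one_left (Real.exp_pos _).le hpi).trans (Real.exp_le_exp.2 ?_)
      nlinarith [sq_nonneg (x + u)]
    _ = Real.exp (-u ^ 2 / 2) / u := by
      rw [integral_const_mul, integral_exp_mul_Iic hu, ← mul_div_assoc, ← Real.exp_add]
      congr 2
      ring

/-- Only the interval `[-t - 1/t, -t]` of length `1/t` is kept: there `x² ≤ t² + 3`, and the
normalising constant costs another `exp (-3/2)`. -/
lemma le_gaussianReal_Iic_neg {t : ℝ} (ht : 1 ≤ t) :
    Real.exp (-t ^ 2 / 2 - 3) / t ≤ (gaussianReal 0 1).real (Set.Iic (-t)) := by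
  have ht0 : 0 < t := by linarith
  have hpi : Real.exp (-(3 / 2)) ≤ (√(2 * Real.pi))⁻¹ := by
    rw [Real.exp_neg]
    apply inv_anti₀ (by positivity)
    rw [Real.sqrt_le_left (Real.exp_pos _).le]
    have := Real.quadratic_le_exp_of_nonneg (x := 3 / 2) (by norm_num)
    nlinarith [Real.pi_lt_four]
  have hvol : (volume : Measure ℝ).real (Set.Icc (-t - 1 / t) (-t)) = 1 / t := by
    rw [Real.volume_real_Icc_of_le (by linarith [one_div_pos.2 ht0])]
    ring
  calc Real.exp (-t ^ 2 / 2 - 3) / t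
      = ∫ _ in Set.Icc (-t - 1 / t) (-t), Real.exp (-t ^ 2 / 2 - 3) := by
        rw [setIntegral_const, hvol, smul_eq_mul]
        ring
    _ ≤ ∫ x in Set.Icc (-t - 1 / t) (-t), gaussianPDFReal 0 1 x := by
      refine setIntegral_mono_on (integrableOn_const (by simp))
        (integrable_gaussianPDFReal 0 1).integrableOn measurableSet_Icc fun x hx => ?_
      simp only [gaussianPDFReal, NNReal.coe_one, mul_one, sub_zero]
      have hx1 : x ^ 2 ≤ (t + 1 / t) ^ 2 := by
        apply sq_le_sq'
        · linarith [hx.1]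
        · linarith [hx.2, one_div_pos.2 ht0]
      have hx2 : (t + 1 / t) ^ 2 ≤ t ^ 2 + 3 := by
        have h1 : 1 / t ≤ 1 := by rw [div_le_one ht0]; exact ht
        have h2 : t * (1 / t) = 1 := by field_simp
        have h3 := one_div_pos.2 ht0
        nlinarith
      calc Real.exp (-t ^ 2 / 2 - 3)
          = Real.exp (-(3 / 2)) * Real.exp (-t ^ 2 / 2 - 3 / 2) := by
            rw [← Real.exp_add]
            congr 1
            ring
        _ ≤ _ := by
            apply mul_le_mul hpi (Real.exp_le_exp.2 (by linarith)) (Real.exp_pos _).le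
            positivity
    _ ≤ ∫ x in Set.Iic (-t), gaussianPDFReal 0 1 x :=
      setIntegral_mono_set (integrable_gaussianPDFReal 0 1).integrableOn
        (ae_of_all _ fun x => gaussianPDFReal_nonneg 0 1 x)
        (Eventually.of_forall fun x hx => hx.2)
    _ = _ := (gaussianReal_real_eq_integral _).symm

/-! ### Counting i.i.d. variables in a set -/

section Count

variable {Ω : Type*} {n : ℕ} {X : Fin n → Ω → ℝ} {μ : Measure ℝ} {B : Set ℝ}

/-- The number of indices `i` with `X i ω ∈ B`, as a real number. -/
noncomputable def count (X : Fin n → Ω → ℝ) (B : Set ℝ) (ω : Ω) : ℝ :=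
  ∑ i, B.indicator 1 (X i ω)

lemma count_eq_sum : count X B = ∑ i, (B.indicator (1 : ℝ → ℝ)) ∘ X i := by
  ext ω
  simp [count]

lemma card_le_count {ω : Ω} (s : Finset (Fin n)) (h : ∀ i ∈ s, X i ω ∈ B) :
    (s.card : ℝ) ≤ count X B ω := by
  calc (s.card : ℝ) = ∑ i ∈ s, B.indicator (1 : ℝ → ℝ) (X i ω) := by
        rw [Finset.sum_congr rfl fun i hi => Set.indicator_of_mem (h i hi) _]
        simp
    _ ≤ _ := Finset.sum_le_sum_of_subset_of_nonneg (Finset.subset_univ _) fun i _ _ =>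
        Set.indicator_nonneg (fun _ _ => zero_le_one) _

variable [MeasurableSpace Ω] {P : Measure Ω}

lemma measurable_indicator_comp (hX : ∀ i, Measurable (X i)) (hB : MeasurableSet B) (i : Fin n) :
    Measurable ((B.indicator (1 : ℝ → ℝ)) ∘ X i) :=
  (measurable_one.indicator hB).comp (hX i)

lemma measurable_count (hX : ∀ i, Measurable (X i)) (hB : MeasurableSet B) :
    Measurable (count X B) := by
  exact Finset.measurable_sum _ fun i _ => measurable_indicator_comp hX hB i

lemma iIndepFun_indicator_comp (hind : iIndepFun X P) (hB : MeasurableSet B) :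
    iIndepFun (fun i => (B.indicator (1 : ℝ → ℝ)) ∘ X i) P :=
  hind.comp (fun _ => B.indicator (1 : ℝ → ℝ)) fun _ => measurable_one.indicator hB

lemma mgf_indicator_comp [IsProbabilityMeasure P]
    (hX : ∀ i, Measurable (X i)) (hμ : ∀ i, P.map (X i) = μ)
    (hB : MeasurableSet B) (s : ℝ) (i : Fin n) :
    mgf ((B.indicator (1 : ℝ → ℝ)) ∘ X i) P s = 1 + μ.real B * (Real.exp s - 1) := by
  have hp : P.real (X i ⁻¹' B) = μ.real B := by
    rw [← hμ i, map_measureReal_apply (hX i) hB]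
  have h : (fun ω => Real.exp (s * ((B.indicator (1 : ℝ → ℝ)) ∘ X i) ω)) =
      fun ω => 1 + (X i ⁻¹' B).indicator (fun _ => Real.exp s - 1) ω := by
    ext ω
    by_cases hω : X i ω ∈ B
    · simp [Set.indicator, hω]
    · simp [Set.indicator, hω]
  rw [mgf, h, integral_add (integrable_const _)
    ((integrable_const _).indicator (hX i hB)), integral_indicator (hX i hB), setIntegral_const,
    hp]
  simp

/-- Chernoff bound for the binomial count. -/
lemma measureReal_le_count [IsProbabilityMeasure P]
    (hX : ∀ i, Measurable (X i)) (hμ : ∀ i, P.map (X i) = μ)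
    (hind : iIndepFun X P) (hB : MeasurableSet B) {s : ℝ} (hs : 0 ≤ s) (c : ℝ) :
    P.real {ω | c ≤ count X B ω} ≤
      Real.exp (n * (μ.real B * (Real.exp s - 1)) - s * c) := by
  have hmeas := measurable_indicator_comp hX hB
  have hint : Integrable (fun ω => Real.exp (s * count X B ω)) P := by
    rw [count_eq_sum]
    refine (iIndepFun_indicator_comp hind hB).integrable_exp_mul_sum hmeas fun i _ => ?_
    refine Integrable.of_bound (C := Real.exp s) (((hmeas i).const_mul s).exp.aestronglyMeasurable)
      (ae_of_all _ fun ω => ?_)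
    rw [Real.norm_eq_abs, Real.abs_exp, Real.exp_le_exp]
    refine mul_le_of_le_one_right hs ?_
    exact Set.indicator_le' (fun _ _ => le_rfl) (fun _ _ => zero_le_one) _
  refine (measure_ge_le_exp_mul_mgf c hs hint).trans ?_
  rw [count_eq_sum, (iIndepFun_indicator_comp hind hB).mgf_sum hmeas,
    Finset.prod_congr rfl fun i _ => mgf_indicator_comp hX hμ hB s i, Finset.prod_const,
    Finset.card_univ, Fintype.card_fin, sub_eq_neg_add (_ * _), Real.exp_add, Real.exp_nat_mul,
    neg_mul]
  have h1 : 1 ≤ Real.exp s := Real.one_le_exp hs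
  have h2 : 0 ≤ μ.real B := measureReal_nonneg
  gcongr
  linarith [Real.add_one_le_exp (μ.real B * (Real.exp s - 1))]

/-- Chebyshev bound for the binomial count. -/
lemma measureReal_add_le_count [IsProbabilityMeasure P]
    (hX : ∀ i, Measurable (X i)) (hμ : ∀ i, P.map (X i) = μ)
    (hind : iIndepFun X P) (hB : MeasurableSet B) {d : ℝ} (hd : 0 < d) :
    P.real {ω | n * μ.real B + d ≤ count X B ω} ≤
      n * (μ.real B * (1 - μ.real B)) / d ^ 2 := by
  have hmeas := measurable_indicator_comp hX hB
  have h01 : ∀ i ω, ((B.indicator (1 : ℝ → ℝ)) ∘ X i) ω ∈ Set.Icc (0 : ℝ) 1 := fun i ω =>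
    ⟨Set.indicator_nonneg (fun _ _ => zero_le_one) _,
      Set.indicator_le' (fun _ _ => le_rfl) (fun _ _ => zero_le_one) _⟩
  have hLp : ∀ i, MemLp ((B.indicator (1 : ℝ → ℝ)) ∘ X i) 2 P := fun i =>
    memLp_of_bounded (ae_of_all _ (h01 i)) (hmeas i).aestronglyMeasurable 2
  have hexp : ∀ i, P[(B.indicator (1 : ℝ → ℝ)) ∘ X i] = μ.real B := fun i => by
    have h : (B.indicator (1 : ℝ → ℝ)) ∘ X i = (X i ⁻¹' B).indicator 1 := rfl
    rw [h, integral_indicator_one (hX i hB), ← hμ i, map_measureReal_apply (hX i) hB]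
  have hmean : P[count X B] = n * μ.real B := by
    rw [count_eq_sum]
    simp only [Finset.sum_apply]
    rw [integral_finsetSum _ fun i _ => (hLp i).integrable (by norm_num),
      Finset.sum_congr rfl fun i _ => hexp i]
    simp
  have hvar : Var[count X B; P] ≤ n * (μ.real B * (1 - μ.real B)) := by
    rw [count_eq_sum, IndepFun.variance_sum (fun i _ => hLp i)
      fun i _ j _ hij => (iIndepFun_indicator_comp hind hB).indepFun hij]
    calc _ ≤ ∑ _i : Fin n, μ.real B * (1 - μ.real B) := by
          refine Finset.sum_le_sum fun i _ => ?_
          -- Bhatia–Davis inequality for a variable with values in `[0, 1]`.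
          have := variance_le_sub_mul_sub (ae_of_all P (h01 i)) (hmeas i).aemeasurable
          rw [hexp i] at this
          linarith
      _ = _ := by simp
  have hLpc : MemLp (count X B) 2 P := by
    rw [count_eq_sum]
    exact memLp_finsetSum' _ fun i _ => hLp i
  calc P.real {ω | n * μ.real B + d ≤ count X B ω}
      ≤ P.real {ω | d ≤ |count X B ω - P[count X B]|} := by
        refine measureReal_mono fun ω hω => ?_
        rw [Set.mem_ofPred_eq] at hω ⊢
        rw [hmean]
        exact le_trans (by linarith) (le_abs_self _)
    _ ≤ Var[count X B; P] / d ^ 2 :=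
        ENNReal.toReal_le_of_le_ofReal (by have := variance_nonneg (count X B) P; positivity)
          (meas_ge_le_variance_div_sq hLpc hd)
    _ ≤ _ := by gcongr

/-- The probability that none of the variables lies in `B`. -/
lemma measureReal_forall_notMem_le (hX : ∀ i, Measurable (X i)) (hμ : ∀ i, P.map (X i) = μ)
    [IsProbabilityMeasure μ] (hind : iIndepFun X P) (hB : MeasurableSet B) :
    P.real {ω | ∀ i, X i ω ∉ B} ≤ Real.exp (-(n * μ.real B)) := by
  have h : {ω | ∀ i, X i ω ∉ B} = ⋂ i ∈ Finset.univ, X i ⁻¹' Bᶜ := by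
    ext ω
    simp
  have hp : ∀ i, P.real (X i ⁻¹' Bᶜ) = 1 - μ.real B := fun i => by
    rw [← map_measureReal_apply (hX i) hB.compl, hμ i, probReal_compl_eq_one_sub hB]
  rw [h, measureReal_def, hind.measure_inter_preimage_eq_mul Finset.univ fun _ _ => hB.compl,
    ENNReal.toReal_prod]
  calc _ = ∏ _i : Fin n, (1 - μ.real B) := Finset.prod_congr rfl fun i _ => hp i
    _ = (1 - μ.real B) ^ n := by simp
    _ ≤ (Real.exp (-μ.real B)) ^ n := by
        gcongr
        · linarith [measureReal_le_one (μ := μ) (s := B)]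
        · exact Real.one_sub_le_exp_neg _
    _ = _ := by rw [← Real.exp_nat_mul]; ring_nf

end Count

/-! ### Order statistics -/

lemma orderStat_one_le {n : ℕ} (Y : Fin n → ℝ) (i : Fin n) : orderStat Y 1 ≤ Y i := by
  have hn : 1 ≤ n := by have := i.2; omega
  rw [orderStat, dif_pos ⟨le_rfl, hn⟩]
  have h := Tuple.monotone_sort Y
  have := h (show (⟨1 - 1, by omega⟩ : Fin n) ≤ (Tuple.sort Y).symm i by
    rw [Fin.le_def]; simp)
  simpa using this

lemma lt_orderStat {Ω : Type*} {n : ℕ} {X : Fin n → Ω → ℝ} {ω : Ω} {j : ℕ} (h1 : 1 ≤ j)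
    (hj : j ≤ n) {x : ℝ} (h : count X (Set.Iic x) ω < j) :
    x < orderStat (fun i => X i ω) j := by
  by_contra! hle
  rw [orderStat, dif_pos ⟨h1, hj⟩] at hle
  have hmono := Tuple.monotone_sort fun i => X i ω
  refine absurd h (not_lt.2 ?_)
  -- The sorted positions `0, …, j - 1` give `j` indices whose values are at most `x`.
  have := card_le_count (X := X) (B := Set.Iic x) (ω := ω)
    ((Finset.Iic (⟨j - 1, by omega⟩ : Fin n)).map (Tuple.sort fun i => X i ω).toEmbedding) (by
      intro i hi
      obtain ⟨m, hm, rfl⟩ := Finset.mem_map.1 hi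
      exact (hmono (Finset.mem_Iic.1 hm)).trans hle)
  rw [Finset.card_map, Fin.card_Iic] at this
  rwa [show j - 1 + 1 = j by omega] at this

/-! ### Gaussian tails at the extreme quantiles -/

/-- The level `t` makes `exp (-t² / 2 - 3)` equal to `(L / n) · e · √(log n)`; the factor `e √(log
n)` pays for the division by `t ≤ 2 √(log n)`. -/
lemma div_le_gaussianReal_Iic {n L : ℝ} (hn : 0 < n) (hN : 0 < Real.log n) (hL : 0 < L)
    (h0 : 0 ≤ Real.log (Real.log n) + 2 * Real.log L + 8)
    (h1 : 1 ≤ 2 * Real.log n - (Real.log (Real.log n) + 2 * Real.log L + 8)) :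
    L / n ≤ (gaussianReal 0 1).real
      (Set.Iic (-√(2 * Real.log n - (Real.log (Real.log n) + 2 * Real.log L + 8)))) := by
  set N := Real.log n with hNdef
  set t := √(2 * N - (Real.log N + 2 * Real.log L + 8)) with ht
  have ht1 : 1 ≤ t := Real.one_le_sqrt.2 h1
  have hsq : t ^ 2 = 2 * N - (Real.log N + 2 * Real.log L + 8) := Real.sq_sqrt (by linarith)
  refine le_trans ?_ (le_gaussianReal_Iic_neg ht1)
  have he : Real.exp (-t ^ 2 / 2 - 3) = L / n * (Real.exp 1 * √N) := by
    have hs : √N = Real.exp (Real.log N / 2) := by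
      rw [← Real.log_sqrt hN.le, Real.exp_log (Real.sqrt_pos.2 hN)]
    rw [hs, ← Real.exp_log (div_pos hL hn), Real.log_div hL.ne' hn.ne', ← Real.exp_add,
      ← Real.exp_add, hsq, ← hNdef]
    congr 1
    ring
  rw [he, le_div_iff₀ (by linarith)]
  refine mul_le_mul_of_nonneg_left ?_ (by positivity)
  have h2 : (2 : ℝ) ≤ Real.exp 1 := by linarith [Real.add_one_le_exp (1 : ℝ)]
  calc t ≤ √(2 ^ 2 * N) := Real.sqrt_le_sqrt (by linarith)
    _ = 2 * √N := by rw [Real.sqrt_mul (by norm_num), Real.sqrt_sq (by norm_num)]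
    _ ≤ _ := by gcongr

/-- The level `u` makes `exp (-u² / 2)` equal to `(j / n) √(α log n / 8)`, and `h` says `u² ≥ (α /
2) log n`, so the root is at most `u / 2`. -/
lemma gaussianReal_Iic_le_div {n j α : ℝ} (hn : 0 < n) (hN : 0 < Real.log n) (hj : 0 < j)
    (hα : 0 < α)
    (h : α / 2 * Real.log n ≤
      2 * (Real.log n - Real.log j) - (Real.log (Real.log n) - Real.log (8 / α))) :
    (gaussianReal 0 1).real
      (Set.Iic (-√(2 * (Real.log n - Real.log j) - (Real.log (Real.log n) - Real.log (8 / α))))) ≤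
      j / (2 * n) := by
  set N := Real.log n with hNdef
  set u := √(2 * (N - Real.log j) - (Real.log N - Real.log (8 / α))) with hu
  have hpos : 0 < α / 2 * N := by positivity
  have hu0 : 0 < u := Real.sqrt_pos.2 (by linarith)
  have hsq : u ^ 2 = 2 * (N - Real.log j) - (Real.log N - Real.log (8 / α)) :=
    Real.sq_sqrt (by linarith)
  refine (gaussianReal_Iic_neg_le hu0).trans ?_
  have he : Real.exp (-u ^ 2 / 2) = j / n * √(α / 8 * N) := by
    have h8 : 0 < α / 8 * N := by positivity
    have hs : √(α / 8 * N) = Real.exp ((Real.log N - Real.log (8 / α)) / 2) := by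
      rw [← Real.log_div hN.ne' (by positivity), show N / (8 / α) = α / 8 * N by field_simp,
        ← Real.log_sqrt h8.le, Real.exp_log (Real.sqrt_pos.2 h8)]
    rw [hs, ← Real.exp_log (div_pos hj hn), Real.log_div hj.ne' hn.ne', ← Real.exp_add, hsq,
      ← hNdef]
    congr 1
    ring
  have hle : √(α / 8 * N) ≤ u / 2 := by
    rw [Real.sqrt_le_left (by linarith)]
    nlinarith
  rw [he, div_le_iff₀ hu0]
  calc j / n * √(α / 8 * N) ≤ j / n * (u / 2) := by gcongr
    _ = _ := by field_simp

/-- Passing from the squared levels to the spacing `t - u`. -/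
lemma spacing_le_mul_sub {N ℓ a b t u ε : ℝ} (hN : 0 < N) (hℓN : ℓ ≤ N)
    (ha : 0 ≤ a) (hb : 0 ≤ b) (ht : 0 < t) (hu : 0 ≤ u) (ht2 : t ^ 2 = 2 * N - a)
    (hu2 : u ^ 2 = 2 * (N - ℓ) - b) (hℓ : 0 ≤ ℓ) (hε : ε ≤ 1) (hab : a - b ≤ 2 * ε * ℓ) :
    2 * N * (1 - √(1 - ℓ / N)) * (1 - ε) ≤ √(2 * N) * (t - u) := by
  set T := √(2 * N) with hT
  set r := √(1 - ℓ / N) with hr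
  have hT2 : T ^ 2 = 2 * N := Real.sq_sqrt (by linarith)
  have hT0 : 0 ≤ T := Real.sqrt_nonneg _
  have hr0 : 0 ≤ r := Real.sqrt_nonneg _
  have hr2 : r ^ 2 = 1 - ℓ / N := Real.sq_sqrt (by rw [sub_nonneg, div_le_one hN]; exact hℓN)
  have hU2 : (T * r) ^ 2 = 2 * (N - ℓ) := by
    rw [mul_pow, hT2, hr2]
    field_simp
  have htT : t ≤ T := abs_le_of_sq_le_sq' (by linarith) hT0 |>.2
  have huU : u ≤ T * r := abs_le_of_sq_le_sq' (by linarith) (by positivity) |>.2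
  have hUT : T * r ≤ T := abs_le_of_sq_le_sq' (by linarith) hT0 |>.2
  -- Compare differences of squares, using `t + u ≤ T + T * r`.
  have key : (T - T * r) * (1 - ε) ≤ t - u := by
    refine le_of_mul_le_mul_right ?_ (show 0 < t + u by linarith)
    calc (T - T * r) * (1 - ε) * (t + u) ≤ (T - T * r) * (1 - ε) * (T + T * r) := by
          refine mul_le_mul_of_nonneg_left (by linarith) ?_
          exact mul_nonneg (by linarith) (by linarith)
      _ = (1 - ε) * (T ^ 2 - (T * r) ^ 2) := by ring
      _ ≤ t ^ 2 - u ^ 2 := by rw [hT2, hU2, ht2, hu2]; linarith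
      _ = _ := by ring
  calc 2 * N * (1 - r) * (1 - ε) = T * ((T - T * r) * (1 - ε)) := by rw [← hT2]; ring
    _ ≤ _ := by gcongr

/-! ### The good event -/

section Event

variable {Ω : Type*} {n : ℕ}

/-- The minimum is at most `-t`, for each `j ∈ S` fewer than `j` variables are at most `-u j`, and
fewer than `m` variables are at most `-x`. -/
def goodEvent (X : Fin n → Ω → ℝ) (S : Finset ℕ) (t x m : ℝ) (u : ℕ → ℝ) : Set Ω :=
  ({ω | ∀ i, X i ω ∉ Set.Iic (-t)} ∪ (⋃ j ∈ S, {ω | (j : ℝ) ≤ count X (Set.Iic (-u j)) ω}) ∪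
    {ω | m ≤ count X (Set.Iic (-x)) ω})ᶜ

variable {X : Fin n → Ω → ℝ} {S : Finset ℕ} {t x m : ℝ} {u : ℕ → ℝ} {ω : Ω}

lemma orderStat_one_le_of_mem_goodEvent (hω : ω ∈ goodEvent X S t x m u) :
    orderStat (fun i => X i ω) 1 ≤ -t := by
  simp only [goodEvent, Set.mem_compl_iff, Set.mem_union, not_or] at hω
  have h := hω.1.1
  simp only [Set.mem_ofPred_eq, not_forall, not_not] at h
  obtain ⟨i, hi⟩ := h
  exact (orderStat_one_le (fun i => X i ω) i).trans hi

lemma lt_orderStat_of_mem_goodEvent (hω : ω ∈ goodEvent X S t x m u) {j : ℕ} (hjS : j ∈ S)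
    (h1 : 1 ≤ j) (hj : j ≤ n) : -u j < orderStat (fun i => X i ω) j := by
  simp only [goodEvent, Set.mem_compl_iff, Set.mem_union, not_or] at hω
  refine lt_orderStat h1 hj ?_
  have h := hω.1.2
  simp only [Set.mem_iUnion, not_exists] at h
  exact not_le.1 (h j hjS)

lemma lt_orderStat_of_mem_goodEvent_of_le (hω : ω ∈ goodEvent X S t x m u) {j : ℕ}
    (hm : m ≤ j) (h1 : 1 ≤ j) (hj : j ≤ n) : -x < orderStat (fun i => X i ω) j := by
  simp only [goodEvent, Set.mem_compl_iff, Set.mem_union, not_or] at hω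
  exact lt_orderStat h1 hj ((not_le.1 hω.2).trans_le hm)

variable [MeasurableSpace Ω]

lemma measurableSet_goodEvent_compl (hX : ∀ i, Measurable (X i)) :
    MeasurableSet ({ω | ∀ i, X i ω ∉ Set.Iic (-t)} ∪
      (⋃ j ∈ S, {ω | (j : ℝ) ≤ count X (Set.Iic (-u j)) ω}) ∪
        {ω | m ≤ count X (Set.Iic (-x)) ω}) := by
  refine MeasurableSet.union (MeasurableSet.union ?_ ?_) ?_
  · simp only [Set.ofPred_forall]
    exact MeasurableSet.iInter fun i => (hX i measurableSet_Iic).compl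
  · exact Finset.measurableSet_biUnion _ fun j _ =>
      measurableSet_le measurable_const (measurable_count hX measurableSet_Iic)
  · exact measurableSet_le measurable_const (measurable_count hX measurableSet_Iic)

lemma measurableSet_goodEvent (hX : ∀ i, Measurable (X i)) :
    MeasurableSet (goodEvent X S t x m u) :=
  (measurableSet_goodEvent_compl hX).compl

lemma sum_exp_neg_le {k : ℝ} (S : Finset ℕ) (hS : ∀ j ∈ S, k ≤ j) :
    ∑ j ∈ S, Real.exp (-(j : ℝ) / 16) ≤ Real.exp (-k / 16) / (1 - Real.exp (-1 / 16)) := by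
  have hr1 : Real.exp (-1 / 16) < 1 := by rw [Real.exp_lt_one_iff]; norm_num
  have hpow : ∀ j : ℕ, Real.exp (-(j : ℝ) / 16) = Real.exp (-1 / 16) ^ j := fun j => by
    rw [← Real.exp_nat_mul]
    congr 1
    ring
  have hsub : S ⊆ Finset.Ico ⌈k⌉₊ (S.sup id + 1) := fun j hj => by
    rw [Finset.mem_Ico]
    exact ⟨Nat.ceil_le.2 (hS j hj), Nat.lt_succ_of_le (Finset.le_sup (f := id) hj)⟩
  calc ∑ j ∈ S, Real.exp (-(j : ℝ) / 16)
      ≤ ∑ j ∈ Finset.Ico ⌈k⌉₊ (S.sup id + 1), Real.exp (-(j : ℝ) / 16) :=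
        Finset.sum_le_sum_of_subset_of_nonneg hsub fun _ _ _ => (Real.exp_pos _).le
    _ ≤ Real.exp (-1 / 16) ^ ⌈k⌉₊ / (1 - Real.exp (-1 / 16)) := by
        simp only [hpow]
        exact geom_sum_Ico_le_of_lt_one (Real.exp_pos _).le hr1
    _ ≤ _ := by
        rw [← hpow]
        have := Nat.le_ceil k
        gcongr

variable {P : Measure Ω} [IsProbabilityMeasure P]

lemma one_sub_le_measureReal_goodEvent (hX : ∀ i, Measurable (X i))
    (hlaw : ∀ i, P.map (X i) = gaussianReal 0 1) (hind : iIndepFun X P) (hn : 0 < n)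
    {k L : ℝ} (hS : ∀ j ∈ S, k ≤ j)
    (ht : L / n ≤ (gaussianReal 0 1).real (Set.Iic (-t)))
    (hu : ∀ j ∈ S, (gaussianReal 0 1).real (Set.Iic (-u j)) ≤ j / (2 * n))
    (hm : n * (gaussianReal 0 1).real (Set.Iic (-x)) < m) :
    1 - (Real.exp (-L) + Real.exp (-k / 16) / (1 - Real.exp (-1 / 16)) +
      n * ((gaussianReal 0 1).real (Set.Iic (-x)) *
        (1 - (gaussianReal 0 1).real (Set.Iic (-x)))) /
          (m - n * (gaussianReal 0 1).real (Set.Iic (-x))) ^ 2) ≤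
      P.real (goodEvent X S t x m u) := by
  have hn' : (0 : ℝ) < n := Nat.cast_pos.2 hn
  rw [goodEvent, probReal_compl_eq_one_sub (measurableSet_goodEvent_compl hX)]
  refine sub_le_sub_left ?_ 1
  refine (measureReal_union_le _ _).trans (add_le_add
    ((measureReal_union_le _ _).trans (add_le_add ?_ ?_)) ?_)
  · refine (measureReal_forall_notMem_le hX hlaw hind measurableSet_Iic).trans ?_
    rw [Real.exp_le_exp, neg_le_neg_iff]
    rwa [div_le_iff₀' hn'] at ht
  · refine (measureReal_biUnion_finset_le _ _).trans
      ((Finset.sum_le_sum fun j hj => ?_).trans (sum_exp_neg_le S hS))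
    -- Chernoff with parameter `1`: a mean of at most `j / 2` and `e - 1 ≤ 15/8` give the exponent
    -- `15j/16 - j = -j/16`.
    refine (measureReal_le_count hX hlaw hind measurableSet_Iic zero_le_one _).trans
      (Real.exp_le_exp.2 ?_)
    have h1 : n * (gaussianReal 0 1).real (Set.Iic (-u j)) ≤ j / 2 := by
      calc _ ≤ (n : ℝ) * (j / (2 * n)) := by gcongr; exact hu j hj
        _ = _ := by field_simp
    have h2 : Real.exp 1 - 1 ≤ 15 / 8 := by linarith [Real.exp_one_lt_d9]
    have h3 : 0 ≤ Real.exp 1 - 1 := by linarith [Real.add_one_le_exp (1 : ℝ)]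
    have h4 : (0 : ℝ) ≤ j := Nat.cast_nonneg j
    calc n * ((gaussianReal 0 1).real (Set.Iic (-u j)) * (Real.exp 1 - 1)) - 1 * j
        = n * (gaussianReal 0 1).real (Set.Iic (-u j)) * (Real.exp 1 - 1) - j := by ring
      _ ≤ j / 2 * (15 / 8) - j := by gcongr
      _ = -(j : ℝ) / 16 := by ring
  · have := measureReal_add_le_count hX hlaw hind (measurableSet_Iic (a := -x)) (sub_pos.2 hm)
    simpa using this

end Event

/-! ### Large `n` -/

lemma eventually_mul_log_add_le (a b : ℝ) {c : ℝ} (hc : 0 < c) :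
    ∀ᶠ y : ℝ in atTop, a * Real.log y + b ≤ c * y := by
  have h1 := (Real.isLittleO_log_id_atTop.const_mul_left a).def (half_pos hc)
  filter_upwards [h1, eventually_ge_atTop (2 * b / c), eventually_ge_atTop 0] with y hy hb h0
  rw [Real.norm_eq_abs, id, Real.norm_of_nonneg h0] at hy
  rw [div_le_iff₀ hc] at hb
  linarith [le_abs_self (a * Real.log y)]

/-- The estimates that hold for all large `n`. -/
structure LargeEnough (ε δ l α κ : ℝ) (n : ℕ) : Prop where
  one_le_log : 1 ≤ Real.log n
  log_le : Real.log n ≤ κ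
  const_le : Real.log (8 / α) ≤ Real.log (Real.log n)
  one_le : 1 ≤ (1 + δ) * Real.log (Real.log n)
  shift_le : Real.log (Real.log n) + 2 * Real.log ((1 + δ) * Real.log (Real.log n)) + 8 ≤
    2 * ε * Real.log n
  shift_le' : Real.log (Real.log n) + 2 * Real.log ((1 + δ) * Real.log (Real.log n)) + 8 ≤
    2 * Real.log n - 1
  diff_le : 2 * Real.log ((1 + δ) * Real.log (Real.log n)) + 8 + Real.log (8 / α) ≤
    2 * ε * Real.log (Real.log n)
  loglog_le : Real.log (Real.log n) ≤ α / 2 * Real.log n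
  log_le_rpow : 3 * Real.log n ≤ (n : ℝ) ^ (α / 2)
  two_le_rpow : 2 ≤ l * (n : ℝ) ^ ((1 - α) / 2)
  rpow_le : Real.log n ^ (1 + δ) ≤ (n : ℝ) ^ ((1 - α) / 2)

lemma eventually_largeEnough {ε δ l α : ℝ} (hδ : 0 < δ) (hε0 : 0 < ε) (hl0 : 0 < l)
    (hα0 : 0 < α) (hα1 : α < 1) {k : ℕ → ℝ}
    (hk : Tendsto (fun n : ℕ => k n / Real.log n) atTop atTop) :
    ∀ᶠ n : ℕ in atTop, LargeEnough ε δ l α (k n) n := by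
  have hlog : Tendsto (fun n : ℕ => Real.log n) atTop atTop :=
    Real.tendsto_log_atTop.comp tendsto_natCast_atTop_atTop
  have hloglog : Tendsto (fun n : ℕ => Real.log (Real.log n)) atTop atTop :=
    Real.tendsto_log_atTop.comp hlog
  have hβ : 0 < (1 - α) / 2 := by linarith
  have hδ1 : 0 < 1 + δ := by linarith
  filter_upwards [hlog.eventually_ge_atTop 1, hk.eventually_ge_atTop 1,
    hloglog.eventually_ge_atTop (Real.log (8 / α)), hloglog.eventually_ge_atTop 1,
    -- The coefficient `1 + 2 * (1 + δ)` comes from the crude bound `log L ≤ L`, with `L = (1 + δ)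
    -- log (log n)`.
    hlog.eventually (eventually_mul_log_add_le (1 + 2 * (1 + δ)) 8 (show 0 < 2 * ε by linarith)),
    hlog.eventually (eventually_mul_log_add_le (1 + 2 * (1 + δ)) 9 two_pos),
    -- Here the variable is `log (log n)`, so `log L` must be expanded exactly as `log (1 + δ) + log
    -- (log (log n))`.
    hloglog.eventually (eventually_mul_log_add_le 2
      (2 * Real.log (1 + δ) + 8 + Real.log (8 / α)) (show 0 < 2 * ε by linarith)),
    hlog.eventually (eventually_mul_log_add_le 1 0 (half_pos hα0)),
    hlog.eventually (eventually_mul_log_add_le 1 (Real.log 3) (half_pos hα0)),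
    hlog.eventually (eventually_mul_log_add_le 0 (Real.log (2 / l)) hβ),
    hlog.eventually (eventually_mul_log_add_le (1 + δ) 0 hβ),
    eventually_gt_atTop 0] with n h1 h2 h3 h4 h5 h6 h7 h8 h9 h10 h11 hn
  have hn' : (0 : ℝ) < n := Nat.cast_pos.2 hn
  have hN : 0 < Real.log n := by linarith
  have hL : Real.log ((1 + δ) * Real.log (Real.log n)) ≤ (1 + δ) * Real.log (Real.log n) :=
    Real.log_le_self (by positivity)
  refine ⟨h1, ?_, h3, ?_, ?_, ?_, ?_, ?_, ?_, ?_, ?_⟩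
  · rwa [le_div_iff₀ hN, one_mul] at h2
  · nlinarith
  · linarith
  · linarith
  · rw [Real.log_mul hδ1.ne' (by linarith)]
    linarith
  · linarith
  · rw [Real.rpow_def_of_pos hn', ← Real.exp_log (show 0 < 3 * Real.log n by positivity),
      Real.exp_le_exp, Real.log_mul (by norm_num) hN.ne']
    linarith
  · rw [← div_le_iff₀' hl0, Real.rpow_def_of_pos hn', ← Real.exp_log (div_pos two_pos hl0),
      Real.exp_le_exp]
    linarith
  · rw [Real.rpow_def_of_pos hn', Real.rpow_def_of_pos hN, Real.exp_le_exp]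
    linarith

/-! ### Size of `λ_n` and `λ̃_n` for large `n`. -/

namespace LargeEnough

variable {ε δ l α κ : ℝ} {n : ℕ}

lemma pos (h : LargeEnough ε δ l α κ n) : 0 < n := by
  rcases Nat.eq_zero_or_pos n with rfl | hn
  · have := h.one_le_log
    simp at this
    linarith
  · exact hn

lemma lam_pos (h : LargeEnough ε δ l α κ n) (hl0 : 0 < l) : 0 < lam l α n := by
  have hn : (0 : ℝ) < n := Nat.cast_pos.2 h.pos
  have := h.one_le_log
  unfold lam
  positivity

/-- The factor `3` bounds the bracket `1 + 2√…` in `lamTilde`, whose root is at most `1` for large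
`n`. -/
lemma three_mul_lam_le (h : LargeEnough ε δ l α κ n) (hl1 : l < 1) :
    3 * lam l α n ≤ (n : ℝ) ^ (-(α / 2)) := by
  have hn : (0 : ℝ) < n := Nat.cast_pos.2 h.pos
  have h1 := h.one_le_log
  calc 3 * lam l α n = l * (3 * Real.log n / (n : ℝ) ^ α) := by unfold lam; ring
    _ ≤ 1 * ((n : ℝ) ^ (α / 2) / (n : ℝ) ^ α) := by
        gcongr
        exact h.log_le_rpow
    _ = (n : ℝ) ^ (-(α / 2)) := by
        rw [one_mul, ← Real.rpow_sub hn]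
        congr 1
        ring

lemma lam_lt_one (h : LargeEnough ε δ l α κ n) (hl0 : 0 < l) (hl1 : l < 1) (hα0 : 0 < α) :
    lam l α n < 1 := by
  have h1 : (1 : ℝ) ≤ n := Nat.one_le_cast.2 h.pos
  have h2 : (n : ℝ) ^ (-(α / 2)) ≤ 1 := Real.rpow_le_one_of_one_le_of_nonpos h1 (by linarith)
  have := h.three_mul_lam_le hl1
  linarith

lemma lamTilde_le (h : LargeEnough ε δ l α κ n) (hl0 : 0 < l) (hl1 : l < 1) :
    lamTilde l α n ≤ (n : ℝ) ^ (-(α / 2)) := by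
  refine le_trans ?_ (h.three_mul_lam_le hl1)
  have hpos := h.lam_pos hl0
  have h2 := h.two_le_rpow
  have hs : √(2 * (1 - lam l α n) / (l * (n : ℝ) ^ ((1 - α) / 2))) ≤ 1 := by
    rw [Real.sqrt_le_left zero_le_one, one_pow, div_le_one (by linarith)]
    linarith
  unfold lamTilde
  nlinarith

/-- Used twice: it keeps `ordLevel` of order `√(log n)`, and its contrapositive places every `j`
with `log j / log n` near `1` above `n λ̃_n`. -/
lemma log_le_of_le (h : LargeEnough ε δ l α κ n) (hl0 : 0 < l) (hl1 : l < 1)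
    {j : ℝ} (hj0 : 0 < j) (hj : j ≤ n * lamTilde l α n) :
    Real.log j ≤ (1 - α / 2) * Real.log n := by
  have hn : (0 : ℝ) < n := Nat.cast_pos.2 h.pos
  calc Real.log j ≤ Real.log (n * (n : ℝ) ^ (-(α / 2))) := by
        apply Real.log_le_log hj0
        refine hj.trans ?_
        gcongr
        exact h.lamTilde_le hl0 hl1
    _ = _ := by
        rw [Real.log_mul hn.ne' (by positivity), Real.log_rpow hn]
        ring

lemma lam_lt_lamTilde (h : LargeEnough ε δ l α κ n) (hl0 : 0 < l) (hl1 : l < 1) (hα0 : 0 < α) :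
    lam l α n < lamTilde l α n := by
  have h0 := h.lam_pos hl0
  have h1 := h.lam_lt_one hl0 hl1 hα0
  have h2 := h.two_le_rpow
  unfold lamTilde
  refine lt_mul_of_one_lt_right h0 ?_
  have : 0 < √(2 * (1 - lam l α n) / (l * (n : ℝ) ^ ((1 - α) / 2))) :=
    Real.sqrt_pos.2 (div_pos (by linarith) (by linarith))
  linarith

/-- With `R = n ^ ((1 - α) / 2)` one has `n λ_n = l (log n) R²`, and the correction in `λ̃_n` turns
the Chebyshev quotient into exactly `1 / (8 (log n) R)`. -/
lemma chebyshev_le (h : LargeEnough ε δ l α κ n) (hl0 : 0 < l) (hl1 : l < 1) (hα0 : 0 < α) :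
    n * (lam l α n * (1 - lam l α n)) / (n * lamTilde l α n - n * lam l α n) ^ 2 ≤
      1 / Real.log n ^ (1 + δ) := by
  have hn : (0 : ℝ) < n := Nat.cast_pos.2 h.pos
  have h0 := h.lam_pos hl0
  have h1 := h.lam_lt_one hl0 hl1 hα0
  have hN := h.one_le_log
  have hN0 : 0 < Real.log n := by linarith
  have hR : 0 < (n : ℝ) ^ ((1 - α) / 2) := by positivity
  have hs : √(2 * (1 - lam l α n) / (l * (n : ℝ) ^ ((1 - α) / 2))) ^ 2 =
      2 * (1 - lam l α n) / (l * (n : ℝ) ^ ((1 - α) / 2)) :=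
    Real.sq_sqrt (div_nonneg (by linarith) (by positivity))
  have hnl : n * lam l α n = l * Real.log n * ((n : ℝ) ^ ((1 - α) / 2)) ^ 2 := by
    have : (n : ℝ) = ((n : ℝ) ^ ((1 - α) / 2)) ^ 2 * (n : ℝ) ^ α := by
      rw [← Real.rpow_natCast, ← Real.rpow_mul hn.le, ← Real.rpow_add hn]
      norm_num
    unfold lam
    nth_rewrite 1 [this]
    have hα : (0 : ℝ) < (n : ℝ) ^ α := by positivity
    field_simp
  have hd : (n * lamTilde l α n - n * lam l α n) ^ 2 =
      (n * lam l α n) ^ 2 * (8 * (1 - lam l α n) / (l * (n : ℝ) ^ ((1 - α) / 2))) := by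
    have : n * lamTilde l α n - n * lam l α n =
        n * lam l α n * (2 * √(2 * (1 - lam l α n) / (l * (n : ℝ) ^ ((1 - α) / 2)))) := by
      unfold lamTilde
      ring
    rw [this, mul_pow, mul_pow 2, hs]
    ring
  have h1' : 1 - lam l α n ≠ 0 := by linarith
  calc n * (lam l α n * (1 - lam l α n)) / (n * lamTilde l α n - n * lam l α n) ^ 2
      = l * (n : ℝ) ^ ((1 - α) / 2) / (8 * (n * lam l α n)) := by
        rw [hd]
        field_simp
    _ = 1 / (8 * Real.log n * (n : ℝ) ^ ((1 - α) / 2)) := by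
        rw [hnl]
        field_simp
    _ ≤ 1 / Real.log n ^ (1 + δ) := by
        refine one_div_le_one_div_of_le (by positivity) (h.rpow_le.trans ?_)
        exact le_mul_of_one_le_left hR.le (by linarith)

end LargeEnough

/-! ### The spacings on the good event -/

/-- `t_n`, where `-t_n` is an upper bound for the minimum. -/
noncomputable def minLevel (δ : ℝ) (n : ℕ) : ℝ :=
  √(2 * Real.log n -
    (Real.log (Real.log n) + 2 * Real.log ((1 + δ) * Real.log (Real.log n)) + 8))

/-- `u_{n,j}`, where `-u_{n,j}` is a lower bound for the `j`-th order statistic. -/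
noncomputable def ordLevel (α : ℝ) (n j : ℕ) : ℝ :=
  √(2 * (Real.log n - Real.log j) - (Real.log (Real.log n) - Real.log (8 / α)))

/-- The indices `j` with `κ ≤ j ≤ n λ̃_n`. -/
noncomputable def lowerIndices (l α κ : ℝ) (n : ℕ) : Finset ℕ :=
  (Finset.Icc 1 n).filter fun j => κ ≤ j ∧ (j : ℝ) ≤ n * lamTilde l α n

namespace LargeEnough

variable {Ω : Type*} {ε δ l α κ : ℝ} {n : ℕ} {X : Fin n → Ω → ℝ}

lemma shift_nonneg (h : LargeEnough ε δ l α κ n) :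
    0 ≤ Real.log (Real.log n) + 2 * Real.log ((1 + δ) * Real.log (Real.log n)) + 8 := by
  have h1 := Real.log_nonneg h.one_le_log
  have h2 := Real.log_nonneg h.one_le
  linarith

lemma minLevel_sq (h : LargeEnough ε δ l α κ n) : minLevel δ n ^ 2 = 2 * Real.log n -
    (Real.log (Real.log n) + 2 * Real.log ((1 + δ) * Real.log (Real.log n)) + 8) :=
  Real.sq_sqrt (by linarith [h.shift_le'])

lemma ordLevel_radicand_ge (h : LargeEnough ε δ l α κ n) (hl0 : 0 < l) (hl1 : l < 1)
    (hα0 : 0 < α) (hα1 : α < 1) {j : ℕ} (hj1 : 1 ≤ j) (hj : (j : ℝ) ≤ n * lamTilde l α n) :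
    α / 2 * Real.log n ≤
      2 * (Real.log n - Real.log j) - (Real.log (Real.log n) - Real.log (8 / α)) := by
  have h1 := h.log_le_of_le hl0 hl1 (Nat.cast_pos.2 hj1) hj
  have h2 := h.loglog_le
  have h3 : 0 ≤ Real.log (8 / α) := Real.log_nonneg (by rw [le_div_iff₀ hα0]; linarith)
  linarith

lemma spacing_ge_of_mem (h : LargeEnough ε δ l α κ n) (hε1 : ε < 1) (hε0 : 0 < ε) (hl0 : 0 < l)
    (hl1 : l < 1) (hα0 : 0 < α) (hα1 : α < 1) {ω : Ω}
    (hω : ω ∈ goodEvent X (lowerIndices l α κ n) (minLevel δ n) (G (lam l α n))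
        (n * lamTilde l α n) (ordLevel α n))
    {j : ℕ} (hj1 : 1 ≤ j) (hjn : j ≤ n) (hκ : κ ≤ j) (hj : (j : ℝ) ≤ n * lamTilde l α n) :
    √(2 * Real.log n) *
        (orderStat (fun i => X i ω) j - orderStat (fun i => X i ω) 1) ≥
      2 * Real.log n * (1 - √(1 - Real.log j / Real.log n)) * (1 - ε) := by
  have hN : 0 < Real.log n := by linarith [h.one_le_log]
  have hmem : j ∈ lowerIndices l α κ n :=
    Finset.mem_filter.2 ⟨Finset.mem_Icc.2 ⟨hj1, hjn⟩, hκ, hj⟩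
  have hj' : (0 : ℝ) < j := Nat.cast_pos.2 hj1
  -- This, from `log n ≤ κ ≤ j`, lets `2ε log j` absorb `a - b`, in which `log (log n)` has
  -- cancelled.
  have hjlog : Real.log (Real.log n) ≤ Real.log j := Real.log_le_log hN (h.log_le.trans hκ)
  have hloglog : 0 ≤ Real.log (Real.log n) := Real.log_nonneg h.one_le_log
  have hrad := h.ordLevel_radicand_ge hl0 hl1 hα0 hα1 hj1 hj
  have hrad0 : 0 ≤ α / 2 * Real.log n := by positivity
  have hdiff := h.diff_le
  have hmul : ε * Real.log (Real.log n) ≤ ε * Real.log j := by gcongr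
  refine (spacing_le_mul_sub (a := Real.log (Real.log n) +
      2 * Real.log ((1 + δ) * Real.log (Real.log n)) + 8)
    (b := Real.log (Real.log n) - Real.log (8 / α)) hN
    (Real.log_le_log hj' (Nat.cast_le.2 hjn)) h.shift_nonneg (by linarith [h.const_le])
    (Real.sqrt_pos.2 (by linarith [h.shift_le'])) (Real.sqrt_nonneg _) h.minLevel_sq
    (Real.sq_sqrt (by linarith)) (by linarith) hε1.le (by linarith)).trans ?_
  refine mul_le_mul_of_nonneg_left ?_ (Real.sqrt_nonneg _)
  have h1 := orderStat_one_le_of_mem_goodEvent hω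
  have h2 := lt_orderStat_of_mem_goodEvent hω hmem hj1 hjn
  unfold minLevel at h1
  unfold ordLevel at h2
  linarith

lemma spacing_gt_of_mem (h : LargeEnough ε δ l α κ n) {ω : Ω}
    (hω : ω ∈ goodEvent X (lowerIndices l α κ n) (minLevel δ n) (G (lam l α n))
        (n * lamTilde l α n) (ordLevel α n))
    {j : ℕ} (hj1 : 1 ≤ j) (hjn : j ≤ n) (hj : n * lamTilde l α n ≤ j) :
    √(2 * Real.log n) *
        (orderStat (fun i => X i ω) j - orderStat (fun i => X i ω) 1) >
      2 * Real.log n * √(1 - ε) - G (lam l α n) * √(2 * Real.log n) := by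
  have hN : 0 < 2 * Real.log n := by linarith [h.one_le_log]
  have h1 := orderStat_one_le_of_mem_goodEvent hω
  have h2 := lt_orderStat_of_mem_goodEvent_of_le hω hj hj1 hjn
  have h3 : √(2 * Real.log n) * √(1 - ε) ≤ minLevel δ n := by
    rw [← Real.sqrt_mul hN.le]
    exact Real.sqrt_le_sqrt (by linarith [h.shift_le])
  have hT : 0 < √(2 * Real.log n) := Real.sqrt_pos.2 hN
  calc 2 * Real.log n * √(1 - ε) - G (lam l α n) * √(2 * Real.log n)
      = √(2 * Real.log n) * (√(2 * Real.log n) * √(1 - ε) - G (lam l α n)) := by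
        rw [mul_sub, ← mul_assoc, Real.mul_self_sqrt hN.le]
        ring
    _ < _ := mul_lt_mul_of_pos_left (by linarith) hT

lemma measureReal_goodEvent_ge [MeasurableSpace Ω] {P : Measure Ω} [IsProbabilityMeasure P]
    (h : LargeEnough ε δ l α κ n) (hl0 : 0 < l) (hl1 : l < 1)
    (hα0 : 0 < α) (hα1 : α < 1) (hX : ∀ i, Measurable (X i))
    (hlaw : ∀ i, P.map (X i) = gaussianReal 0 1) (hind : iIndepFun X P) :
    P.real (goodEvent X (lowerIndices l α κ n) (minLevel δ n) (G (lam l α n))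
        (n * lamTilde l α n) (ordLevel α n)) ≥
      1 - 4 * (1 / Real.log n ^ (1 + δ) + Real.exp (-κ / 16) / (1 - Real.exp (-1 / 16))) := by
  have hn : (0 : ℝ) < n := Nat.cast_pos.2 h.pos
  have hN : 0 < Real.log n := by linarith [h.one_le_log]
  have hp : (gaussianReal 0 1).real (Set.Iic (-G (lam l α n))) = lam l α n := by
    rw [gaussianReal_Iic_neg, one_sub_Phi_G (h.lam_pos hl0) (h.lam_lt_one hl0 hl1 hα0)]
  have hprob := one_sub_le_measureReal_goodEvent (S := lowerIndices l α κ n)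
    (t := minLevel δ n) (x := G (lam l α n)) (m := n * lamTilde l α n) (u := ordLevel α n)
    (k := κ) (L := (1 + δ) * Real.log (Real.log n)) hX hlaw hind h.pos
    (fun j hj => (Finset.mem_filter.1 hj).2.1)
    (div_le_gaussianReal_Iic hn hN (by linarith [h.one_le]) h.shift_nonneg
      (by linarith [h.shift_le']))
    (fun j hj => by
      obtain ⟨hj1, hj2⟩ := Finset.mem_filter.1 hj
      have hj0 := (Finset.mem_Icc.1 hj1).1
      exact gaussianReal_Iic_le_div hn hN (Nat.cast_pos.2 hj0) hα0
        (h.ordLevel_radicand_ge hl0 hl1 hα0 hα1 hj0 hj2.2))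
    (by
      rw [hp]
      exact mul_lt_mul_of_pos_left (h.lam_lt_lamTilde hl0 hl1 hα0) hn)
  rw [hp] at hprob
  have hexp : Real.exp (-((1 + δ) * Real.log (Real.log n))) = 1 / Real.log n ^ (1 + δ) := by
    rw [Real.exp_neg, one_div, Real.rpow_def_of_pos hN, mul_comm]
  rw [hexp] at hprob
  have hcheb := h.chebyshev_le hl0 hl1 hα0
  have h1 : 0 < 1 / Real.log n ^ (1 + δ) := by positivity
  have h2 : 0 ≤ Real.exp (-κ / 16) / (1 - Real.exp (-1 / 16)) := by
    refine div_nonneg (Real.exp_pos _).le (sub_nonneg.2 (Real.exp_le_one_iff.2 (by norm_num)))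
  -- The three failure bounds contribute `1 / (log n) ^ (1 + δ)` twice and the geometric term once,
  -- so the factor `4` leaves room.
  linarith

end LargeEnough

end GaussianSpacings

theorem proposition2p2 (ε δ l α : ℝ) (hδ : 0 < δ) (hε0 : 0 < ε) (hε1 : ε < 1)
    (hl0 : 0 < l) (hl1 : l < 1) (hα0 : 0 < α) (hα1 : α < 1)
    (k : ℕ → ℝ) (hk : Tendsto k atTop atTop)
    (hk_div : Tendsto (fun n : ℕ => k n / Real.log n) atTop atTop)
    (hk_log : Tendsto (fun n : ℕ => Real.log (k n) / Real.log n) atTop (𝓝 0)) :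
    ∃ n₀ : ℕ, ∀ (Ω : ℕ → Type*) [∀ n, MeasurableSpace (Ω n)]
      (P : (n : ℕ) → Measure (Ω n)) [∀ n, IsProbabilityMeasure (P n)]
      (X : (n : ℕ) → Fin n → Ω n → ℝ),
      (∀ n i, Measurable (X n i)) →
      (∀ n i, (P n).map (X n i) = gaussianReal 0 1) →
      (∀ n, iIndepFun (X n) (P n)) →
      ∃ E : (n : ℕ) → Set (Ω n),
        (∀ n, n₀ ≤ n →
          MeasurableSet (E n) ∧
          (P n).real (E n) ≥
            1 - 4 * (1 / (Real.log n) ^ (1 + δ)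
              + Real.exp (-(k n) / 16) / (1 - Real.exp (-1 / 16))) ∧
          ∀ ω ∈ E n,
            (∀ j : ℕ, 1 ≤ j → j ≤ n → k n ≤ j → (j : ℝ) ≤ n * GaussianSpacings.lamTilde l α n →
              √(2 * Real.log n) *
                  (GaussianSpacings.orderStat (fun i => X n i ω) j
                    - GaussianSpacings.orderStat (fun i => X n i ω) 1) ≥
                2 * Real.log n * (1 - √(1 - Real.log j / Real.log n)) * (1 - ε)) ∧
            (∀ j : ℕ, 1 ≤ j → j ≤ n → (n : ℝ) * GaussianSpacings.lamTilde l α n ≤ j →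
              √(2 * Real.log n) *
                  (GaussianSpacings.orderStat (fun i => X n i ω) j
                    - GaussianSpacings.orderStat (fun i => X n i ω) 1) >
                2 * Real.log n * √(1 - ε)
                  - GaussianSpacings.G (GaussianSpacings.lam l α n) * √(2 * Real.log n))) ∧
        (∀ j : ℕ → ℕ, (∀ n, 1 ≤ n → 1 ≤ j n ∧ j n ≤ n) →
          Tendsto (fun n : ℕ => Real.log (j n) / Real.log n) atTop (𝓝 1) →
          ∀ᶠ n in atTop, ∀ ω ∈ E n,
            √(2 * Real.log n) *
                (GaussianSpacings.orderStat (fun i => X n i ω) (j n)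
                  - GaussianSpacings.orderStat (fun i => X n i ω) 1) >
              2 * Real.log n * √(1 - ε)
                - GaussianSpacings.G (GaussianSpacings.lam l α n) * √(2 * Real.log n)) := by
  -- All estimates on `n` are deterministic, so `n₀` is fixed before the probability spaces.
  obtain ⟨n₀, hn₀⟩ := eventually_atTop.1
    (GaussianSpacings.eventually_largeEnough (l := l) hδ hε0 hl0 hα0 hα1 hk_div)
  refine ⟨n₀, fun Ω _ P _ X hX hlaw hind => ⟨fun n =>
    GaussianSpacings.goodEvent (X n) (GaussianSpacings.lowerIndices l α (k n) n)
      (GaussianSpacings.minLevel δ n) (GaussianSpacings.G (GaussianSpacings.lam l α n))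
      (n * GaussianSpacings.lamTilde l α n) (GaussianSpacings.ordLevel α n), ?_, ?_⟩⟩
  · intro n hn
    have h := hn₀ n hn
    refine ⟨GaussianSpacings.measurableSet_goodEvent (hX n),
      h.measureReal_goodEvent_ge hl0 hl1 hα0 hα1 (hX n) (hlaw n) (hind n), fun ω hω => ⟨?_, ?_⟩⟩
    · intro j hj1 hjn hκ hj
      exact h.spacing_ge_of_mem hε1 hε0 hl0 hl1 hα0 hα1 hω hj1 hjn hκ hj
    · intro j hj1 hjn hj
      exact h.spacing_gt_of_mem hω hj1 hjn hj
  · intro j hj hjlog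
    filter_upwards [eventually_ge_atTop n₀, eventually_ge_atTop 1,
      hjlog.eventually (lt_mem_nhds (show 1 - α / 2 < 1 by linarith))] with n hn h1 hlt ω hω
    have h := hn₀ n hn
    refine h.spacing_gt_of_mem hω (hj n h1).1 (hj n h1).2 ?_
    -- If `j n < n λ̃_n`, then `log (j n) ≤ (1 - α / 2) log n`, contradicting the limit `1`.
    by_contra! hle
    have hlog := h.log_le_of_le hl0 hl1 (Nat.cast_pos.2 (hj n h1).1) hle.le
    rw [lt_div_iff₀ (by linarith [h.one_le_log])] at hlt
    linarith
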